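/- Let $X$ be a Tychonoff (completely regular Hausdorff) space which contains an infinite compact subset, and let $Y$ be an infinite Tychonoff space containing a non-scattered compact subset, i.e. a compact subset $L$ for which some nonempty $A\subseteq L$ has no isolated point in its relative topology. Let $C_k(Y)$ be the space of continuous real-valued functions on $Y$ with the compact-open topology, and let $C_k(Y)_w$ be the same vector space endowed with its weak topology $\sigma(C_k(Y),C_k(Y)')$. Let $C_p(X,C_k(Y)_w)$ be the space of all continuous functions from $X$ to $C_k(Y)_w$ with the topology of pointwise convergence, and let $(c_0)_p=\{x\in\mathbb{R}^{\mathbb{N}} : x(n)\to 0\}$ carry the pointwise topology inherited from $\mathbb{R}^{\mathbb{N}}$. Then $C_p(X,C_k(Y)_w)$ contains a complemented copy of $(c_0)_p$; that is, there are closed linear subspaces $E_1,E_2$ of $C_p(X,C_k(Y)_w)$ such that $C_p(X,C_k(Y)_w)=E_1\oplus E_2$ algebraically, $E_1$ is linearly homeomorphic to $(c_0)_p$, and the projection onto $E_1$ along $E_2$ is continuous. -/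

import Mathlib

open Filter Topology

/-- A subset `S` of a topological space is scattered (in its relative topology) if every nonempty
subset of `S` has an isolated point. -/
def IsScatteredSet {Y : Type*} [TopologicalSpace Y] (S : Set Y) : Prop :=
  ∀ A : Set Y, A ⊆ S → A.Nonempty → ∃ x ∈ A, ∃ U : Set Y, IsOpen U ∧ U ∩ A = {x}

/-- `Cp X E` is the vector space of all continuous functions from `X` to the topological vector
space `E`, with the topology of pointwise convergence, that is, the subspace topology inherited
from the product `X → E`. -/
def Cp (X E : Type*) [TopologicalSpace X] [AddCommGroup E] [Module ℝ E] [TopologicalSpace E]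
    [ContinuousAdd E] [ContinuousConstSMul ℝ E] : Submodule ℝ (X → E) where
  carrier := {f | Continuous f}
  add_mem' hf hg := hf.add hg
  zero_mem' := continuous_const
  smul_mem' c _ hf := hf.const_smul c

/-- `c0p` is the space `(c₀)_p` of real sequences converging to `0`, with the pointwise topology
inherited from the product `ℕ → ℝ`. -/
def c0p : Submodule ℝ (ℕ → ℝ) where
  carrier := {a | Tendsto a atTop (𝓝 0)}
  add_mem' ha hb := by
    simpa [Pi.add_def] using Tendsto.add ha hb
  zero_mem' := tendsto_const_nhds
  smul_mem' c _ ha := by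
    simpa [Pi.smul_def] using Tendsto.const_smul ha c

/-- The topological vector space `E` contains a complemented copy of `F`: there are closed linear
subspaces `E₁`, `E₂` with `E = E₁ ⊕ E₂` algebraically, such that `E₁` is linearly homeomorphic to
`F` and the projection of `E` onto `E₁` along `E₂` is continuous. -/
def ContainsComplementedCopy (E F : Type*) [AddCommGroup E] [Module ℝ E] [TopologicalSpace E]
    [AddCommGroup F] [Module ℝ F] [TopologicalSpace F] : Prop :=
  ∃ (E₁ E₂ : Submodule ℝ E) (h : IsCompl E₁ E₂),
    IsClosed (E₁ : Set E) ∧ IsClosed (E₂ : Set E) ∧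
    Nonempty (E₁ ≃L[ℝ] F) ∧ Continuous (E₁.projectionOnto E₂ h)

/-! Take points `x n` in the compact subset of `X` with disjoint neighbourhoods and bumps `g n`. On
a subset of `L` without isolated points, build functions `r n` on `Y` that behave like Rademacher
functions: all finite sign patterns occur, so weak compactness of the probability measures on `L`
gives `μ` for which the `r n` are orthonormal. Put T a = ∑ a n • (g n ⊗ r n) and P f = (∫ f (x n) *
r n ∂μ)ₙ; then P ∘ T = id.

The crux is that P f is null (`tendsto_integralMulCLM_zero`). The values of f on the compact set,
restricted to `L`, form a bounded, pointwise compact family, so each subsequence of f (x n) has a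
further one converging pointwise to some f z. Dominated convergence handles f (x n) - f z, and
Bessel's inequality handles f z. -/

/-- A continuous linear retraction `P` of a continuous linear map `T` exhibits a complemented
copy. -/
theorem containsComplementedCopy_of_leftInverse {E F : Type*} [AddCommGroup E] [Module ℝ E]
    [TopologicalSpace E] [IsTopologicalAddGroup E] [T2Space E] [AddCommGroup F] [Module ℝ F]
    [TopologicalSpace F] [T1Space F] (P : E →L[ℝ] F) (T : F →L[ℝ] E)
    (h : Function.LeftInverse P T) : ContainsComplementedCopy E F := by
  have hc := ContinuousLinearMap.isTopCompl_range_ker_of_leftInverse T P h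
  refine ⟨_, _, hc.isCompl, ?_, ?_, ⟨?_⟩, hc.continuous_projectionOnto⟩
  · have : ((LinearMap.range T.toLinearMap : Submodule ℝ E) : Set E) = {x | T (P x) = x} := by
      ext x
      constructor
      · rintro ⟨a, rfl⟩
        exact congrArg T (h a)
      · intro hx
        exact ⟨P x, hx⟩
    rw [this]
    exact isClosed_eq (T.continuous.comp P.continuous) continuous_id
  · exact isClosed_singleton.preimage P.continuous
  · exact
      { toFun := fun x => P x
        map_add' := fun x y => by simp
        map_smul' := fun c x => by simp
        invFun := fun a => ⟨T a, a, rfl⟩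
        left_inv := by
          rintro ⟨_, a, rfl⟩
          exact Subtype.ext (congrArg T (h a))
        right_inv := h
        continuous_toFun := P.continuous.comp continuous_subtype_val
        continuous_invFun := T.continuous.subtype_mk _ }

/-! ### Disjoint neighbourhoods in `X` -/

/-- An infinite compact subset of a Hausdorff space contains a sequence whose terms have pairwise
disjoint open neighbourhoods in the whole space. -/
theorem IsCompact.exists_seq_mem_isOpen_pairwise_disjoint {X : Type*} [TopologicalSpace X]
    [T2Space X] {K : Set X} (hK : IsCompact K) (hKinf : K.Infinite) :
    ∃ (x : ℕ → X) (U : ℕ → Set X), (∀ n, x n ∈ K) ∧ (∀ n, IsOpen (U n)) ∧ (∀ n, x n ∈ U n) ∧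
      Pairwise (Function.onFun Disjoint U) := by
  obtain ⟨p, -, hp⟩ := hKinf.exists_accPt_of_subset_isCompact hK subset_rfl
  -- A triple is a point, a neighbourhood of it, and a disjoint neighbourhood of the accumulation
  -- point `p`; later points are chosen inside all earlier neighbourhoods of `p`.
  obtain ⟨f, hf, hr⟩ := exists_seq_of_forall_finset_exists
    (fun t : X × Set X × Set X => t.1 ∈ K ∧ IsOpen t.2.1 ∧ t.1 ∈ t.2.1 ∧ t.2.2 ∈ 𝓝 p ∧
      Disjoint t.2.1 t.2.2) (fun t t' => t'.2.1 ⊆ t.2.2) (by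
      intro s hs
      have hW : (⋂ t ∈ s, t.2.2) ∈ 𝓝 p := by
        rw [Filter.biInter_finset_mem]
        exact fun t ht => (hs t ht).2.2.2.1
      obtain ⟨y, ⟨hyW, hyK⟩, hyp⟩ := accPt_iff_nhds.1 hp _ (interior_mem_nhds.2 hW)
      obtain ⟨U, V, hU, hV, hyU, hpV, hUV⟩ := t2_separation hyp
      refine ⟨(y, U ∩ interior (⋂ t ∈ s, t.2.2), V), ⟨hyK, hU.inter isOpen_interior, ⟨hyU, hyW⟩,
        hV.mem_nhds hpV, hUV.mono_left Set.inter_subset_left⟩, fun t ht => ?_⟩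
      exact (Set.inter_subset_right.trans interior_subset).trans (Set.biInter_subset_of_mem ht))
  refine ⟨fun n => (f n).1, fun n => (f n).2.1, fun n => (hf n).1, fun n => (hf n).2.1,
    fun n => (hf n).2.2.1, ?_⟩
  have key : ∀ m n, m < n → Disjoint (f m).2.1 (f n).2.1 := fun m n hmn =>
    (hf m).2.2.2.2.mono_right (hr m n hmn)
  intro m n hmn
  exact hmn.lt_or_gt.elim (key m n) fun h => (key n m h).symm

/-! ### Rademacher-like functions on a set without isolated points -/

/-- The value `1` or `-1` assigned to a truth value. -/
def boolSign (b : Bool) : ℝ := cond b 1 (-1)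

/-- Disjoint finite subsets of a Tychonoff space are separated by a continuous function that is
locally constant near them. -/
theorem exists_continuousMap_eventually_eq_one_neg_one {Y : Type*} [TopologicalSpace Y]
    [T35Space Y] {S T : Set Y} (hS : S.Finite) (hT : T.Finite) (hST : Disjoint S T) :
    ∃ g : C(Y, ℝ), (∀ y, |g y| ≤ 1) ∧ (∀ a ∈ S, ∀ᶠ y in 𝓝 a, g y = 1) ∧
      ∀ a ∈ T, ∀ᶠ y in 𝓝 a, g y = -1 := by
  -- Height 4 makes the sum exceed 3 near `S`, while it stays below 1 near `T`; subtracting 2 and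
  -- clamping to [-1, 1] then gives local constancy.
  have hu : ∀ a : Y, ∃ u : C(Y, ℝ), (a ∈ S → u a = 4) ∧ (∀ y, 0 ≤ u y) ∧ ∀ y ∈ T, u y = 0 := by
    intro a
    by_cases ha : a ∈ S
    · obtain ⟨f, hf, hfa, hfT⟩ := CompletelyRegularSpace.completely_regular a T hT.isClosed
        (Set.disjoint_left.1 hST ha)
      refine ⟨⟨fun y => 4 * (1 - (f y : ℝ)), by fun_prop⟩, fun _ => by simp [hfa], fun y => ?_,
        fun y hy => by simp [hfT hy]⟩
      have := (f y).2.2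
      simp only [ContinuousMap.coe_mk]
      linarith
    · exact ⟨0, fun h => absurd h ha, fun y => le_rfl, fun y _ => rfl⟩
  choose u hu1 hu0 huT using hu
  let v : C(Y, ℝ) := ∑ a ∈ hS.toFinset, u a
  have hv : ∀ y, v y = ∑ a ∈ hS.toFinset, u a y := fun y => by simp [v]
  refine ⟨⟨fun y => max (-1) (min 1 (v y - 2)), by fun_prop⟩, fun y => ?_, fun a ha => ?_,
    fun a ha => ?_⟩
  · exact abs_le.2 ⟨le_max_left _ _, max_le (by norm_num) (min_le_left _ _)⟩
  · have h : 3 < v a := by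
      rw [hv]
      have := Finset.single_le_sum (f := fun b => u b a) (fun b _ => hu0 b a)
        (hS.mem_toFinset.2 ha)
      simp only [hu1 a ha] at this
      linarith
    filter_upwards [v.continuous.continuousAt.eventually (lt_mem_nhds h)] with y hy
    simp only [ContinuousMap.coe_mk]
    rw [min_eq_left (by linarith), max_eq_right (by norm_num)]
  · have h : v a < 1 := by
      rw [hv, Finset.sum_eq_zero fun b _ => huT b a ha]
      norm_num
    filter_upwards [v.continuous.continuousAt.eventually (gt_mem_nhds h)] with y hy
    simp only [ContinuousMap.coe_mk]
    exact max_eq_left ((min_le_right _ _).trans (by linarith))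

/-- Every sign pattern of length `n` is attained by `r 0, …, r (n - 1)` near some point of `A`. -/
def AttainsSigns {Y : Type*} [TopologicalSpace Y] (A : Set Y) (n : ℕ) (r : ℕ → C(Y, ℝ)) : Prop :=
  (∀ i y, |r i y| ≤ 1) ∧
    ∀ s : Fin n → Bool, ∃ a ∈ A, ∀ᶠ y in 𝓝 a, ∀ i : Fin n, r i y = boolSign (s i)

/-- Each pattern holds on an open set meeting `A`, which therefore contains a second point of `A`;
the new function is 1 near one point and -1 near the other. -/
theorem AttainsSigns.exists_update {Y : Type*} [TopologicalSpace Y] [T35Space Y] {A : Set Y}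
    (hA : ∀ x ∈ A, ∀ U : Set Y, IsOpen U → U ∩ A ≠ {x}) {n : ℕ} {r : ℕ → C(Y, ℝ)}
    (hr : AttainsSigns A n r) : ∃ g, AttainsSigns A (n + 1) (Function.update r n g) := by
  obtain ⟨hr1, hr⟩ := hr
  choose a haA ha using hr
  have hb : ∀ s, ∃ b ∈ A, b ≠ a s ∧ ∀ᶠ y in 𝓝 b, ∀ i : Fin n, r i y = boolSign (s i) := by
    intro s
    obtain ⟨U, hU, hUo, haU⟩ := eventually_nhds_iff.1 (ha s)
    by_contra hcon
    refine hA (a s) (haA s) U hUo (Set.Subset.antisymm ?_ ?_)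
    · rintro b ⟨hbU, hbA⟩
      by_contra hne
      exact hcon ⟨b, hbA, hne, eventually_nhds_iff.2 ⟨U, hU, hUo, hbU⟩⟩
    · rintro _ rfl
      exact ⟨haU, haA s⟩
  choose b hbA hba hb using hb
  have hinj : Function.Injective boolSign := by
    intro p q h
    cases p <;> cases q <;> first | rfl | (norm_num [boolSign] at h)
  have hdisj : Disjoint (Set.range a) (Set.range b) := by
    rw [Set.disjoint_left]
    rintro _ ⟨s, rfl⟩ ⟨s', hs'⟩
    have hss : s = s' := by
      funext i
      refine hinj ?_
      rw [← (ha s).self_of_nhds i, ← (hb s').self_of_nhds i, hs']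
    subst hss
    exact hba s hs'
  obtain ⟨g, hg1, hga, hgb⟩ := exists_continuousMap_eventually_eq_one_neg_one
    (Set.finite_range a) (Set.finite_range b) hdisj
  refine ⟨g, fun i y => ?_, fun s => ?_⟩
  · by_cases hi : i = n
    · subst hi
      simpa using hg1 y
    · simpa [Function.update_of_ne hi] using hr1 i y
  · have key : ∀ c, (∀ᶠ y in 𝓝 c, ∀ i : Fin n, r i y = boolSign (s i.castSucc)) →
        (∀ᶠ y in 𝓝 c, g y = boolSign (s (Fin.last n))) →
        ∀ᶠ y in 𝓝 c, ∀ i : Fin (n + 1), Function.update r n g i y = boolSign (s i) := by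
      intro c h1 h2
      filter_upwards [h1, h2] with y h1 h2 i
      refine Fin.lastCases ?_ (fun j => ?_) i
      · simpa using h2
      · simpa [Function.update_of_ne j.2.ne] using h1 j
    cases hs : s (Fin.last n) with
    | true =>
      refine ⟨a fun i => s i.castSucc, haA _, key _ (ha _) ?_⟩
      simpa [hs, boolSign] using hga _ ⟨_, rfl⟩
    | false =>
      refine ⟨b fun i => s i.castSucc, hbA _, key _ (hb _) ?_⟩
      simpa [hs, boolSign] using hgb _ ⟨_, rfl⟩

/-- On a nonempty set without isolated points there is a sequence of continuous functions that
attains every finite sign pattern. -/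
theorem exists_seq_attains_signs {Y : Type*} [TopologicalSpace Y] [T35Space Y] {A : Set Y}
    (hne : A.Nonempty) (hA : ∀ x ∈ A, ∀ U : Set Y, IsOpen U → U ∩ A ≠ {x}) :
    ∃ r : ℕ → C(Y, ℝ), (∀ i y, |r i y| ≤ 1) ∧
      ∀ n (s : Fin n → Bool), ∃ a ∈ A, ∀ i : Fin n, r i a = boolSign (s i) := by
  choose! g hg using fun n r => AttainsSigns.exists_update hA (n := n) (r := r)
  let R : ℕ → ℕ → C(Y, ℝ) := fun n => Nat.rec 0 (fun n r => Function.update r n (g n r)) n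
  have hRs : ∀ n, R (n + 1) = Function.update (R n) n (g n (R n)) := fun n => rfl
  have hR : ∀ n, AttainsSigns A n (R n) := by
    intro n
    induction n with
    | zero =>
      obtain ⟨a, ha⟩ := hne
      exact ⟨fun i y => by simp [R], fun s => ⟨a, ha, Eventually.of_forall fun y i => i.elim0⟩⟩
    | succ n ih => exact hg n (R n) ih
  -- Entry `i` is fixed at stage `i + 1` and never changed again, so the diagonal is the limit
  -- sequence.
  have hstab : ∀ i n, i < n → R n i = R (i + 1) i := by
    intro i n hin
    induction n, hin using Nat.le_induction with
    | base => rfl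
    | succ n hn ih =>
      rw [hRs, Function.update_of_ne (Nat.ne_of_lt hn), ih]
  refine ⟨fun i => R (i + 1) i, fun i y => (hR (i + 1)).1 i y, fun n s => ?_⟩
  obtain ⟨a, haA, ha⟩ := (hR n).2 s
  refine ⟨a, haA, fun i => ?_⟩
  rw [← ha.self_of_nhds i, hstab i n i.2]

/-! ### An orthonormalizing measure -/

theorem sum_boolSign_mul_boolSign {n : ℕ} (i j : Fin n) :
    ∑ s : Fin n → Bool, boolSign (s i) * boolSign (s j) = if i = j then 2 ^ n else 0 := by
  have hsq : ∀ b, boolSign b * boolSign b = 1 := by rintro (_ | _) <;> simp [boolSign]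
  split_ifs with h
  · subst h
    simp [hsq]
  -- Flipping the `i`-th sign negates the summand.
  · refine Finset.sum_involution (fun s _ => Function.update s i (!s i)) ?_ ?_ ?_ ?_
    · intro s _
      have hnot : ∀ b, boolSign (!b) = -boolSign b := by rintro (_ | _) <;> simp [boolSign]
      simp [Function.update_of_ne (Ne.symm h), hnot]
    · intro s _ _ hs
      simpa using congrFun hs i
    · intro s _
      exact Finset.mem_univ _
    · intro s _
      simp

open MeasureTheory in
/-- Continuous functions on a compact space that attain all sign patterns form an orthonormal
sequence for some probability measure. -/
theorem exists_probabilityMeasure_integral_mul_eq_ite {L : Type*} [TopologicalSpace L]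
    [CompactSpace L] [T2Space L] [MeasurableSpace L] [BorelSpace L] (r : ℕ → C(L, ℝ))
    (hr : ∀ n (s : Fin n → Bool), ∃ y, ∀ i : Fin n, r i y = boolSign (s i)) :
    ∃ μ : ProbabilityMeasure L, ∀ i j, ∫ y, r i y * r j y ∂(μ : Measure L) =
      if i = j then 1 else 0 := by
  let Z : ℕ → Set (ProbabilityMeasure L) := fun n =>
    {μ | ∀ i < n, ∀ j < n, ∫ y, r i y * r j y ∂(μ : Measure L) = if i = j then 1 else 0}
  have hZc : ∀ n, IsClosed (Z n) := by
    intro n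
    simp only [Z, Set.ofPred_forall]
    refine isClosed_iInter fun i => isClosed_iInter fun _ => isClosed_iInter fun j =>
      isClosed_iInter fun _ => isClosed_eq ?_ continuous_const
    exact ProbabilityMeasure.continuous_integral_boundedContinuousFunction
      (BoundedContinuousFunction.mkOfCompact (r i * r j))
  have hZne : ∀ n, (Z n).Nonempty := by
    intro n
    -- The witness is the uniform measure on the sign cube, pushed to points realizing the patterns.
    choose y hy using hr n
    let _ : MeasurableSpace (Fin n → Bool) := ⊤
    let p : Measure (Fin n → Bool) := (PMF.uniformOfFintype (Fin n → Bool)).toMeasure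
    have hym : Measurable y := measurable_from_top
    have : IsProbabilityMeasure (p.map y) := Measure.isProbabilityMeasure_map hym.aemeasurable
    refine ⟨⟨p.map y, this⟩, fun i hi j hj => ?_⟩
    simp only [ProbabilityMeasure.coe_mk]
    rw [integral_map (f := fun y => r i y * r j y) hym.aemeasurable
      (r i * r j).continuous.aestronglyMeasurable,
      PMF.integral_eq_sum]
    have h1 : ∀ s, r i (y s) * r j (y s) = boolSign (s ⟨i, hi⟩) * boolSign (s ⟨j, hj⟩) :=
      fun s => by rw [← hy s ⟨i, hi⟩, ← hy s ⟨j, hj⟩]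
    simp only [h1, PMF.uniformOfFintype_apply, smul_eq_mul, ← Finset.mul_sum,
      sum_boolSign_mul_boolSign, Fin.mk.injEq]
    split_ifs <;> simp
  obtain ⟨μ, hμ⟩ := IsCompact.nonempty_iInter_of_sequence_nonempty_isCompact_isClosed Z
    (fun n μ hμ i hi j hj => hμ i (hi.trans n.lt_succ_self) j (hj.trans n.lt_succ_self)) hZne
    (hZc 0).isCompact hZc
  refine ⟨μ, fun i j => ?_⟩
  exact Set.mem_iInter.1 hμ (max i j + 1) i (Nat.lt_succ_of_le (le_max_left _ _)) j
    (Nat.lt_succ_of_le (le_max_right _ _))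

/-! ### Pointwise compactness and null integrals -/

/-- A sequence in a bounded pointwise compact family of continuous functions on a compact space
has a pointwise convergent subsequence with limit in the family. -/
theorem exists_subseq_tendsto_pointwise {K L : Type*} [TopologicalSpace K] [CompactSpace K]
    [TopologicalSpace L] [CompactSpace L] (F : K → C(L, ℝ)) (hF : ∀ y, Continuous fun x => F x y)
    {M : ℝ} (hM : ∀ x y, |F x y| ≤ M) (x : ℕ → K) :
    ∃ (φ : ℕ → ℕ) (z : K), StrictMono φ ∧
      ∀ y, Tendsto (fun k => F (x (φ k)) y) atTop (𝓝 (F z y)) := by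
  -- `π` identifies points that no `F (x n)` distinguishes; its image is separable, so convergence
  -- need only be arranged on a countable `D`.
  let π : L → ℕ → ℝ := fun y n => F (x n) y
  have hπ : Continuous π := by fun_prop
  obtain ⟨D, hD, hDd⟩ : ∃ D : Set L, D.Countable ∧ Set.range π ⊆ closure (π '' D) := by
    obtain ⟨t, htr, htc, ht⟩ :=
      (TopologicalSpace.IsSeparable.of_separableSpace (Set.range π)).exists_countable_dense_subset
    have : Countable t := htc
    choose g hg using fun a : t => htr a.2
    refine ⟨Set.range g, Set.countable_range g, ht.trans (closure_mono ?_)⟩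
    intro a ha
    exact ⟨g ⟨a, ha⟩, ⟨_, rfl⟩, hg ⟨a, ha⟩⟩
  have : Countable D := hD
  obtain ⟨c, -, φ, hφ, hc⟩ := (isCompact_univ_pi fun _ : D => isCompact_Icc (a := -M)
    (b := M)).tendsto_subseq (x := fun n (d : D) => F (x n) d)
    fun n d _ => abs_le.1 (hM (x n) d)
  have hlim : ∀ (g : Ultrafilter ℕ) (w : K), Tendsto (fun k => x (φ k)) g (𝓝 w) →
      ∀ y, Tendsto (fun k => F (x (φ k)) y) g (𝓝 (F w y)) :=
    fun g w hw y => ((hF y).tendsto w).comp hw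
  have hcl : ∀ g : Ultrafilter ℕ, ∃ w, Tendsto (fun k => x (φ k)) g (𝓝 w) := by
    intro g
    obtain ⟨w, -, hw⟩ := isCompact_univ.ultrafilter_le_nhds (g.map fun k => x (φ k)) (by simp)
    exact ⟨w, hw⟩
  have hvalD : ∀ (g : Ultrafilter ℕ), (g : Filter ℕ) ≤ atTop → ∀ w,
      Tendsto (fun k => x (φ k)) g (𝓝 w) → ∀ d : D, F w d = c d := by
    intro g hg w hw d
    exact tendsto_nhds_unique (hlim g w hw d) ((tendsto_pi_nhds.1 hc d).mono_left hg)
  obtain ⟨g₀, hg₀⟩ := Ultrafilter.exists_le (atTop : Filter ℕ)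
  obtain ⟨z, hz⟩ := hcl g₀
  refine ⟨φ, z, hφ, fun y => tendsto_iff_ultrafilter _ _ _ |>.2 fun g hg => ?_⟩
  obtain ⟨w, hw⟩ := hcl g
  have hclosed : IsClosed {y | F w y = F z y} :=
    isClosed_eq (F w).continuous (F z).continuous
  have hsub : π '' D ⊆ π '' {y | F w y = F z y} := Set.image_mono fun d hd =>
    (hvalD g hg w hw ⟨d, hd⟩).trans (hvalD g₀ hg₀ z hz ⟨d, hd⟩).symm
  -- `y` need not lie in the closure of `D`, but some `y'` in its `π`-fibre satisfies `F w y' = F z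
  -- y'`, and ultrafilter limits of the `F (x n)` are constant on fibres.
  obtain ⟨y', hy', hyy⟩ :=
    closure_minimal hsub (hclosed.isCompact.image hπ).isClosed (hDd ⟨y, rfl⟩)
  have hfib : ∀ (g : Ultrafilter ℕ) (w : K), Tendsto (fun k => x (φ k)) g (𝓝 w) →
      F w y = F w y' := fun g w hw => tendsto_nhds_unique (hlim g w hw y) (by
    simpa only [show ∀ n, F (x n) y' = F (x n) y from fun n => congrFun hyy n]
      using hlim g w hw y')
  have : F w y = F z y := by
    rw [hfib g w hw, hfib g₀ z hz]
    exact hy'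
  rw [← this]
  exact hlim g w hw y

open MeasureTheory in
/-- Integration of the product with a fixed continuous function, as a functional on continuous
functions on a compact space. -/
noncomputable def integralMulCLM {L : Type*} [TopologicalSpace L] [CompactSpace L]
    [MeasurableSpace L] [BorelSpace L] (μ : Measure L) [IsFiniteMeasure μ] (r : C(L, ℝ)) :
    C(L, ℝ) →L[ℝ] ℝ :=
  (innerSL ℝ (ContinuousMap.toLp 2 μ ℝ r)).comp (ContinuousMap.toLp 2 μ ℝ)

open MeasureTheory in
theorem integralMulCLM_apply {L : Type*} [TopologicalSpace L] [CompactSpace L]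
    [MeasurableSpace L] [BorelSpace L] (μ : Measure L) [IsFiniteMeasure μ] (r f : C(L, ℝ)) :
    integralMulCLM μ r f = ∫ y, f y * r y ∂μ := by
  simp [integralMulCLM, ContinuousMap.inner_toLp]

open MeasureTheory in
/-- Integration against a bounded orthonormal sequence tends to zero along any sequence in a
bounded pointwise compact family of continuous functions. -/
theorem tendsto_integralMulCLM_zero {K L : Type*} [TopologicalSpace K] [CompactSpace K]
    [TopologicalSpace L] [CompactSpace L] [MeasurableSpace L] [BorelSpace L] (μ : Measure L)
    [IsFiniteMeasure μ] (r : ℕ → C(L, ℝ)) (hr1 : ∀ n y, |r n y| ≤ 1)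
    (hr : ∀ i j, ∫ y, r i y * r j y ∂μ = if i = j then 1 else 0) (F : K → C(L, ℝ))
    (hF : ∀ y, Continuous fun x => F x y) {M : ℝ} (hM : ∀ x y, |F x y| ≤ M) (x : ℕ → K) :
    Tendsto (fun n => integralMulCLM μ (r n) (F (x n))) atTop (𝓝 0) := by
  have horth : Orthonormal ℝ fun n => ContinuousMap.toLp 2 μ ℝ (r n) := by
    rw [orthonormal_iff_ite]
    intro i j
    rw [ContinuousMap.inner_toLp, ← hr]
    simp [mul_comm]
  have hBessel : ∀ f : C(L, ℝ), Tendsto (fun n => integralMulCLM μ (r n) f) atTop (𝓝 0) := by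
    intro f
    have h := (horth.inner_products_summable (ContinuousMap.toLp 2 μ ℝ f)).tendsto_atTop_zero
    simp only [Real.norm_eq_abs, sq_abs] at h
    have h' := h.sqrt
    simp only [Real.sqrt_sq_eq_abs, Real.sqrt_zero] at h'
    exact (tendsto_zero_iff_abs_tendsto_zero _).2 h'
  refine tendsto_of_subseq_tendsto fun ns hns => ?_
  obtain ⟨φ, z, hφ, hz⟩ := exists_subseq_tendsto_pointwise F hF hM fun k => x (ns k)
  refine ⟨φ, ?_⟩
  have h1 : Tendsto (fun k => ∫ y, (F (x (ns (φ k))) y - F z y) * r (ns (φ k)) y ∂μ) atTop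
      (𝓝 (∫ _, 0 ∂μ)) := by
    refine tendsto_integral_of_dominated_convergence (fun _ => M + M) (fun k => ?_)
      (integrable_const _) (fun k => ?_) ?_
    · exact Continuous.aestronglyMeasurable (by fun_prop)
    · refine Eventually.of_forall fun y => ?_
      rw [norm_mul, Real.norm_eq_abs, Real.norm_eq_abs]
      refine (mul_le_of_le_one_right (abs_nonneg _) (hr1 _ y)).trans ?_
      exact (abs_sub _ _).trans (add_le_add (hM _ _) (hM _ _))
    · refine Eventually.of_forall fun y => ?_
      refine squeeze_zero_norm (a := fun k => |F (x (ns (φ k))) y - F z y|) (fun k => ?_) ?_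
      · rw [norm_mul, Real.norm_eq_abs, Real.norm_eq_abs]
        exact mul_le_of_le_one_right (abs_nonneg _) (hr1 _ y)
      · simpa using ((hz y).sub_const (F z y)).abs
  have h2 := (hBessel (F z)).comp (hns.comp hφ.tendsto_atTop)
  rw [integral_zero] at h1
  have h3 := h1.add h2
  rw [add_zero] at h3
  refine h3.congr fun k => ?_
  have h4 : ∫ y, (F (x (ns (φ k))) y - F z y) * r (ns (φ k)) y ∂μ =
      integralMulCLM μ (r (ns (φ k))) (F (x (ns (φ k))) - F z) :=
    (integralMulCLM_apply μ (r (ns (φ k))) (F (x (ns (φ k))) - F z)).symm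
  rw [h4, map_sub]
  simp

/-! ### Weak topology -/

/-- Point evaluations separate functions, which makes the weak topology Hausdorff, as the closedness
of the copy requires. -/
instance {Y : Type*} [TopologicalSpace Y] : SeparatingDual ℝ C(Y, ℝ) where
  exists_ne_zero' f hf := by
    obtain ⟨y, hy⟩ := DFunLike.ne_iff.1 hf
    exact ⟨ContinuousMap.evalCLM ℝ y, hy⟩

/-- A continuous functional, as a continuous functional for the weak topology. -/
noncomputable def ContinuousLinearMap.onWeakSpace {E : Type*} [AddCommGroup E] [Module ℝ E]
    [TopologicalSpace E] (l : E →L[ℝ] ℝ) : WeakSpace ℝ E →L[ℝ] ℝ where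
  toLinearMap := l.toLinearMap.comp (toWeakSpace ℝ E).symm.toLinearMap
  cont := WeakBilin.eval_continuous (topDualPairing ℝ E).flip l

/-- A weakly continuous family indexed by a compact space is norm bounded. -/
theorem exists_norm_le_of_forall_continuous {K E : Type*} [TopologicalSpace K] [CompactSpace K]
    [NormedAddCommGroup E] [NormedSpace ℝ E] (F : K → E)
    (hF : ∀ l : E →L[ℝ] ℝ, Continuous fun x => l (F x)) : ∃ M, ∀ x, ‖F x‖ ≤ M := by
  obtain ⟨M, hM⟩ := banach_steinhaus (g := fun x => NormedSpace.inclusionInDoubleDual ℝ E (F x))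
    fun l => by
      obtain ⟨C, hC⟩ := isCompact_univ.exists_bound_of_continuousOn (hF l).continuousOn
      exact ⟨C, fun x => hC x (Set.mem_univ x)⟩
  refine ⟨M, fun x => ?_⟩
  rw [← (NormedSpace.inclusionInDoubleDualLi ℝ (E := E)).norm_map]
  exact hM x

/-! ### The two operators -/

/-- A null sequence combined with functions of disjoint supports gives a continuous function into
the space of continuous functions. -/
theorem continuous_smul_of_disjoint_supports {X Y : Type*} [TopologicalSpace X]
    [TopologicalSpace Y] {g : ℕ → C(X, ℝ)} (hg : ∀ n x, |g n x| ≤ 1) {h : ℕ → C(Y, ℝ)}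
    (hh : ∀ n y, |h n y| ≤ 1) {N : X → ℕ} (hN : ∀ n x, n ≠ N x → g n x = 0) {a : ℕ → ℝ}
    (ha : Tendsto a atTop (𝓝 0)) : Continuous fun x => (a (N x) * g (N x) x) • h (N x) := by
  refine ContinuousMap.continuous_of_continuous_uncurry _ ?_
  have hsum : ∀ (m : ℕ) (p : X × Y), ∑ n ∈ Finset.range m, a n * g n p.1 * h n p.2 =
      if N p.1 < m then a (N p.1) * g (N p.1) p.1 * h (N p.1) p.2 else 0 := by
    intro m p
    rw [← Finset.sum_congr rfl fun n _ => show (if n = N p.1 then a n * g n p.1 * h n p.2 else 0) =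
      a n * g n p.1 * h n p.2 by
        split_ifs with hn
        · rfl
        · simp [hN n p.1 hn]]
    simp
  -- At each point at most one term is nonzero, so the tail past `m` is bounded by some `|a n|` with
  -- `n ≥ m`.
  refine TendstoUniformly.continuous
    (F := fun (m : ℕ) (p : X × Y) => ∑ n ∈ Finset.range m, a n * g n p.1 * h n p.2) (p := atTop)
    ?_ (Frequently.of_forall fun m => by fun_prop)
  rw [Metric.tendstoUniformly_iff]
  intro ε hε
  obtain ⟨m₀, hm₀⟩ := Metric.tendsto_atTop.1 ha ε hε
  filter_upwards [eventually_ge_atTop m₀] with m hm p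
  rw [hsum]
  simp only [Function.uncurry_def, ContinuousMap.smul_apply, smul_eq_mul]
  split_ifs with hlt
  · simpa using hε
  · have h1 := hm₀ (N p.1) (hm.trans (not_lt.1 hlt))
    rw [Real.dist_eq, sub_zero] at h1 ⊢
    rw [abs_mul, abs_mul]
    refine lt_of_le_of_lt ?_ h1
    exact (mul_le_of_le_one_right (by positivity) (hh _ _)).trans
      (mul_le_of_le_one_right (abs_nonneg _) (hg _ _))

/-- The operator from null sequences to `Cp X C(Y, ℝ)_w` given by functions of disjoint supports
on `X` and a bounded sequence of functions on `Y`. -/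
noncomputable def c0pToCp {X Y : Type*} [TopologicalSpace X] [TopologicalSpace Y] (g : ℕ → C(X, ℝ))
    (hg : ∀ n x, |g n x| ≤ 1) (h : ℕ → C(Y, ℝ)) (hh : ∀ n y, |h n y| ≤ 1) (N : X → ℕ)
    (hN : ∀ n x, n ≠ N x → g n x = 0) : c0p →L[ℝ] Cp X (WeakSpace ℝ C(Y, ℝ)) where
  toFun a := ⟨fun x => toWeakSpace ℝ C(Y, ℝ) ((a.1 (N x) * g (N x) x) • h (N x)),
    (toWeakSpaceCLM ℝ C(Y, ℝ)).continuous.comp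
      (continuous_smul_of_disjoint_supports hg hh hN a.2)⟩
  map_add' a b := Subtype.ext <| funext fun x => by
    simp [add_mul, add_smul]
  map_smul' c a := Subtype.ext <| funext fun x => by
    simp [mul_assoc, mul_smul]
  cont := by
    refine Continuous.subtype_mk (continuous_pi fun x => ?_) _
    refine (toWeakSpaceCLM ℝ C(Y, ℝ)).continuous.comp ?_
    have : Continuous fun a : c0p => a.1 (N x) :=
      (continuous_apply (N x)).comp continuous_subtype_val
    exact (this.mul continuous_const).smul continuous_const

/-- The operator from `Cp X E_w` to null sequences given by points of `X` and functionals
on `E`. -/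
noncomputable def cpToC0p {X E : Type*} [TopologicalSpace X] [AddCommGroup E] [Module ℝ E] [TopologicalSpace E]
    [IsTopologicalAddGroup E] [ContinuousConstSMul ℝ E]
    (x : ℕ → X) (l : ℕ → E →L[ℝ] ℝ)
    (hl : ∀ f : Cp X (WeakSpace ℝ E),
      Tendsto (fun n => (l n).onWeakSpace (f.1 (x n))) atTop (𝓝 0)) :
    Cp X (WeakSpace ℝ E) →L[ℝ] c0p where
  toFun f := ⟨fun n => (l n).onWeakSpace (f.1 (x n)), hl f⟩
  map_add' f f' := Subtype.ext <| funext fun n => by simp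
  map_smul' c f := Subtype.ext <| funext fun n => by simp
  cont := by
    refine Continuous.subtype_mk (continuous_pi fun n => ?_) _
    exact (l n).onWeakSpace.continuous.comp
      ((continuous_apply (x n)).comp continuous_subtype_val)

/-- Bump functions at points with pairwise disjoint neighbourhoods, together with an index
selecting the only one that may be nonzero. -/
theorem exists_bumps_of_pairwise_disjoint {X : Type*} [TopologicalSpace X] [T35Space X]
    {x : ℕ → X} {U : ℕ → Set X} (hU : ∀ n, IsOpen (U n)) (hx : ∀ n, x n ∈ U n)
    (hd : Pairwise (Function.onFun Disjoint U)) :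
    ∃ (g : ℕ → C(X, ℝ)) (N : X → ℕ), (∀ n y, |g n y| ≤ 1) ∧ (∀ n, g n (x n) = 1) ∧
      (∀ n, N (x n) = n) ∧ ∀ n y, n ≠ N y → g n y = 0 := by
  classical
  choose f hf hf0 hf1 using fun n =>
    CompletelyRegularSpace.completely_regular_isOpen (x n) (U n) (hU n) (hx n)
  -- The default index 0 is harmless: outside every `U n` all bumps vanish.
  have hN : ∀ y n, y ∈ U n → (if h : ∃ n, y ∈ U n then h.choose else 0) = n := by
    intro y n hy
    have h : ∃ n, y ∈ U n := ⟨n, hy⟩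
    rw [dif_pos h]
    by_contra hne
    exact Set.disjoint_left.1 (hd hne) h.choose_spec hy
  refine ⟨fun n => ⟨fun y => 1 - f n y, by fun_prop⟩,
    fun y => if h : ∃ n, y ∈ U n then h.choose else 0, fun n y => ?_, fun n => ?_,
    fun n => hN _ n (hx n), fun n y hy => ?_⟩
  · have h1 := (f n y).2.1
    have h2 := (f n y).2.2
    exact abs_le.2 ⟨by simp only [ContinuousMap.coe_mk]; linarith,
      by simp only [ContinuousMap.coe_mk]; linarith⟩
  · simp [hf0]
  · have : y ∉ U n := fun h => hy (hN y n h).symm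
    simp [hf1 n this]

theorem mainTheorem10 {X Y : Type*} [TopologicalSpace X] [T35Space X]
    [TopologicalSpace Y] [T35Space Y] [Infinite Y]
    (hX : ∃ K : Set X, IsCompact K ∧ K.Infinite)
    (hY : ∃ L : Set Y, IsCompact L ∧ ¬ IsScatteredSet L) :
    ContainsComplementedCopy (Cp X (WeakSpace ℝ C(Y, ℝ))) c0p := by
  obtain ⟨K, hK, hKinf⟩ := hX
  obtain ⟨L, hL, hLs⟩ := hY
  obtain ⟨x, U, hxK, hU, hxU, hd⟩ := hK.exists_seq_mem_isOpen_pairwise_disjoint hKinf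
  obtain ⟨g, N, hg1, hgx, hNx, hgN⟩ := exists_bumps_of_pairwise_disjoint hU hxU hd
  obtain ⟨A, hAL, hAne, hA⟩ : ∃ A ⊆ L, A.Nonempty ∧
      ∀ x ∈ A, ∀ U : Set Y, IsOpen U → U ∩ A ≠ {x} := by
    unfold IsScatteredSet at hLs
    push Not at hLs
    exact hLs
  obtain ⟨r, hr1, hr⟩ := exists_seq_attains_signs hAne hA
  have : CompactSpace K := isCompact_iff_compactSpace.1 hK
  have : CompactSpace L := isCompact_iff_compactSpace.1 hL
  let _ : MeasurableSpace L := borel L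
  have : BorelSpace L := ⟨rfl⟩
  let ι : C(L, Y) := ⟨Subtype.val, continuous_subtype_val⟩
  let res : C(Y, ℝ) →L[ℝ] C(L, ℝ) := ContinuousMap.compCLM ℝ ℝ ι
  obtain ⟨μ, hμ⟩ := exists_probabilityMeasure_integral_mul_eq_ite (fun n => res (r n))
    fun n s => by
      obtain ⟨a, haA, ha⟩ := hr n s
      exact ⟨⟨a, hAL haA⟩, ha⟩
  let l : ℕ → C(Y, ℝ) →L[ℝ] ℝ := fun n => (integralMulCLM μ (res (r n))).comp res
  have hlim : ∀ f : Cp X (WeakSpace ℝ C(Y, ℝ)),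
      Tendsto (fun n => (l n).onWeakSpace (f.1 (x n))) atTop (𝓝 0) := by
    intro f
    let F : K → C(L, ℝ) := fun k => res ((toWeakSpace ℝ C(Y, ℝ)).symm (f.1 k))
    have hF : ∀ m : C(L, ℝ) →L[ℝ] ℝ, Continuous fun k => m (F k) := fun m =>
      (m.comp res).onWeakSpace.continuous.comp (f.2.comp continuous_subtype_val)
    obtain ⟨M, hM⟩ := exists_norm_le_of_forall_continuous F hF
    exact tendsto_integralMulCLM_zero μ (fun n => res (r n)) (fun n y => hr1 n y) hμ F
      (fun y => hF (ContinuousMap.evalCLM ℝ y)) (fun k y => ((F k).norm_coe_le_norm y).trans (hM k))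
      fun n => ⟨x n, hxK n⟩
  refine containsComplementedCopy_of_leftInverse (cpToC0p x l hlim)
    (c0pToCp g hg1 r hr1 N hgN) fun a => Subtype.ext <| funext fun n => ?_
  change l n ((a.1 (N (x n)) * g (N (x n)) (x n)) • r (N (x n))) = a.1 n
  rw [hNx, hgx, mul_one, map_smul]
  have : l n (r n) = 1 := by
    change integralMulCLM μ (res (r n)) (res (r n)) = 1
    rw [integralMulCLM_apply, hμ, if_pos rfl]
  rw [this, smul_eq_mul, mul_one]
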